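/- For $n\ge 1$ let $L_n$ be the unoriented linear graph on $[n]=\{1,\dots,n\}$ with edges $1\leftrightarrow 2\leftrightarrow\cdots\leftrightarrow n$, each unoriented edge being identified with the two oriented edges $i\to i+1$ and $i+1\to i$, and let $E_0$ be the set of these oriented edges. Let $E_{\mathrm{open}}\subset ([n]\times[n])\setminus E_0$ be random: independently of each other, each rightward edge $i\to j$ with $j>i+1$ belongs to $E_{\mathrm{open}}$ with probability $p_{\mathrm{right}}=p_{\mathrm{right}}(n)\in[0,1]$, and each leftward edge $i\to j$ with $j<i-1$ with probability $p_{\mathrm{left}}=p_{\mathrm{left}}(n)\in[0,1]$; self-loops are never in $E_{\mathrm{open}}$. For $t\ge 0$ put $$E_{t+1}=E_t\cup\{\,i\to j\in E_{\mathrm{open}} : i\to k\in E_t \text{ and } k\to j\in E_t \text{ for some } k\in[n]\,\},\qquad E_\infty=\bigcup_{t\ge 0}E_t .$$ The length of an edge $i\to j$ is the number of edges on a shortest path from $i$ to $j$ in $L_n$, that is, $|i-j|$. Theorem. For every $c_1>0$ there is a $c_2>0$, depending only on $c_1$, such that the following holds. If $p_{\mathrm{left}}(n)<n^{-c_1}$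 and $p_{\mathrm{right}}(n)<c_2$ for all sufficiently large $n$, then asymptotically almost surely (i.e. with probability tending to $1$ as $n\to\infty$) $E_\infty$ contains no edge longer than $\log n$. -/

import Mathlib

open Filter Topology MeasureTheory ProbabilityTheory

namespace TransitiveClosure

/-- One step of the dynamics: an open edge `i → j` becomes occupied if there are occupied
edges `i → k` and `k → j` for some vertex `k`. -/
def step {V : Type*} (Eopen E : Set (V × V)) : Set (V × V) :=
  E ∪ {e | e ∈ Eopen ∧ ∃ k : V, (e.1, k) ∈ E ∧ (k, e.2) ∈ E}

/-- The set `E_t` of edges occupied at time `t`. -/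
def occupied {V : Type*} (E₀ Eopen : Set (V × V)) : ℕ → Set (V × V)
  | 0 => E₀
  | t + 1 => step Eopen (occupied E₀ Eopen t)

/-- The set `E_∞` of eventually occupied edges. -/
def eventuallyOccupied {V : Type*} (E₀ Eopen : Set (V × V)) : Set (V × V) :=
  ⋃ t : ℕ, occupied E₀ Eopen t

/-- The oriented edges of an unoriented graph: each edge counts in both directions. -/
def orientedEdges {V : Type*} (G : SimpleGraph V) : Set (V × V) :=
  {e | G.Adj e.1 e.2}

/-- The open edges of a configuration `ω`, when `E₀` is initially occupied: all initially
occupied edges and all self-loops are excluded. -/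
def openEdges {V : Type*} (E₀ : Set (V × V)) (ω : V × V → Bool) : Set (V × V) :=
  {e | e ∉ E₀ ∧ e.1 ≠ e.2 ∧ ω e = true}

/-- The density of rightward edges `i → j`, `i < j`, is `pRight`; that of leftward edges
`i → j`, `j < i`, is `pLeft` (the value at self-loops is irrelevant: they are never open). -/
noncomputable def edgeDensity {n : ℕ} (pLeft pRight : unitInterval) (e : Fin n × Fin n) :
    unitInterval :=
  if e.1 < e.2 then pRight else pLeft

/-- The law of the random configuration on `n` vertices: the coordinates are independent, and
the coordinate of `e` is `true` with probability `edgeDensity pLeft pRight e`. -/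
noncomputable def configMeasure (n : ℕ) (pLeft pRight : unitInterval) :
    Measure (Fin n × Fin n → Bool) :=
  Measure.pi fun e => bernoulliMeasure true false (edgeDensity pLeft pRight e)

/-- The set `E_∞` for the process started from the unoriented linear graph on `n` vertices. -/
def linearFinal (n : ℕ) (ω : Fin n × Fin n → Bool) : Set (Fin n × Fin n) :=
  eventuallyOccupied (orientedEdges (SimpleGraph.pathGraph n))
    (openEdges (orientedEdges (SimpleGraph.pathGraph n)) ω)

/-- The length of an edge `i → j`: the number of edges on a shortest path from `i` to `j` in the
linear graph. -/
noncomputable def edgeLength {n : ℕ} (e : Fin n × Fin n) : ℕ :=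
  (SimpleGraph.pathGraph n).dist e.1 e.2

end TransitiveClosure

/-!
Let `2 ^ m` be a constant with `m * c₁ ≥ 2`. If some leftward edge longer than `2 ^ m` is ever
occupied, look at the first time this happens: all leftward lengths are then at most
`2 ^ (m + 1)`, and following the longer half of each splitting produces `m + 1` distinct open
leftward edges in a window of bounded size. By a union bound this has probability
`O(n * pLeft ^ (m + 1)) = O(1 / n)`.

Otherwise unfold an occupied edge `a → b` into its splittings `a → k → b`, stopping at every edge
whose interior vertices have all been covered before. Each unfolded edge adds at most one new
interior vertex to those of its parts, namely `k`, so at least `b - a - 1` distinct open rightward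
edges are found. The unfolding is a walk from `a` to `b` which steps left only by bounded amounts,
so `N` unfolded edges are recorded by a word of length `O(N)` in four letters. Hence there are at
most `n * C ^ N` sets of `N` such edges, each of them open with probability `pRight ^ N`; for small
`pRight` and `N ≥ ⌊log n⌋` the sum of these is `O(1 / n)` as well.
-/

namespace TransitiveClosure

section Dynamics

variable {V : Type*} {E₀ Eopen : Set (V × V)} {t : ℕ} {e : V × V}

theorem occupied_subset_occupied_succ : occupied E₀ Eopen t ⊆ occupied E₀ Eopen (t + 1) :=
  Set.subset_union_left

theorem mem_open_and_exists_of_mem_occupied_succ (he : e ∈ occupied E₀ Eopen (t + 1))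
    (het : e ∉ occupied E₀ Eopen t) :
    e ∈ Eopen ∧ ∃ k, (e.1, k) ∈ occupied E₀ Eopen t ∧ (k, e.2) ∈ occupied E₀ Eopen t :=
  he.resolve_left het

end Dynamics

section LeftwardEdges

variable {n : ℕ} {E E₀ Eopen : Set (Fin n × Fin n)}

/-- No edge of `E` points more than `D` vertices to the left. -/
def LeftBounded (E : Set (Fin n × Fin n)) (D : ℕ) : Prop :=
  ∀ e ∈ E, (e.1 : ℕ) ≤ e.2 + D

theorem LeftBounded.step {D : ℕ} (hE : LeftBounded E D) : LeftBounded (step Eopen E) (2 * D) := by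
  rintro e (he | ⟨-, k, hk₁, hk₂⟩)
  · have := hE e he
    omega
  · have h₁ := hE _ hk₁
    have h₂ := hE _ hk₂
    dsimp only at h₁ h₂
    omega

theorem LeftBounded.exists_half {D q : ℕ} (hE : LeftBounded E D) {a k b : Fin n}
    (hak : (a, k) ∈ E) (hkb : (k, b) ∈ E) (hab : (b : ℕ) + 2 ^ (q + 1) < a) :
    ∃ e ∈ E, (e.2 : ℕ) + 2 ^ q < e.1 ∧ (e.1 : ℕ) ∈ Finset.Icc ((a : ℕ) - D) (a + D) := by
  have h₁ := hE _ hak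
  have h₂ := hE _ hkb
  dsimp only at h₁ h₂
  rw [pow_succ] at hab
  by_cases hlong : (k : ℕ) + 2 ^ q < a
  · exact ⟨(a, k), hak, hlong, by simp⟩
  · exact ⟨(k, b), hkb, by dsimp only; omega, by simp only [Finset.mem_Icc]; omega⟩

theorem exists_leftward_of_leftBounded {D t : ℕ} (hE₀ : LeftBounded E₀ 1)
    (hD : LeftBounded (occupied E₀ Eopen t) D) {q : ℕ} {e : Fin n × Fin n}
    (he : e ∈ occupied E₀ Eopen t) (hlong : (e.2 : ℕ) + 2 ^ q < e.1) :
    ∃ A : Finset (Fin n × Fin n), A.card = q + 1 ∧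
      ∀ f ∈ A, f ∈ occupied E₀ Eopen t ∧ f ∈ Eopen ∧ f.2 < f.1 ∧
        (f.1 : ℕ) ∈ Finset.Icc ((e.1 : ℕ) - q * D) (e.1 + q * D) := by
  have hpow (r : ℕ) : 1 ≤ 2 ^ r := Nat.one_le_two_pow
  induction t generalizing q e with
  | zero =>
    have := hE₀ e he
    have := hpow q
    omega
  | succ t ih =>
    have hDt : LeftBounded (occupied E₀ Eopen t) D := fun f hf ↦
      hD f (occupied_subset_occupied_succ hf)
    by_cases het : e ∈ occupied E₀ Eopen t
    · obtain ⟨A, hcard, hA⟩ := ih hDt het hlong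
      exact ⟨A, hcard, fun f hf ↦ (hA f hf).imp_left fun h ↦ occupied_subset_occupied_succ h⟩
    obtain ⟨hopen, k, hk₁, hk₂⟩ := mem_open_and_exists_of_mem_occupied_succ he het
    have hleft : e.2 < e.1 := by
      have := hpow q
      rw [Fin.lt_def]
      omega
    cases q with
    | zero => exact ⟨{e}, rfl, by simpa using ⟨he, hopen, hleft⟩⟩
    | succ q =>
      obtain ⟨e', he', hlong', hnear⟩ := hDt.exists_half hk₁ hk₂ hlong
      obtain ⟨A, hcard, hA⟩ := ih hDt he' hlong'
      have heA : e ∉ A := fun h ↦ het (hA e h).1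
      refine ⟨insert e A, by rw [Finset.card_insert_of_notMem heA, hcard],
        Finset.forall_mem_insert _ _ _ |>.2 ⟨⟨he, hopen, hleft, by simp⟩, fun f hf ↦ ?_⟩⟩
      obtain ⟨hft, hfopen, hfleft, hfnear⟩ := hA f hf
      refine ⟨occupied_subset_occupied_succ hft, hfopen, hfleft, ?_⟩
      rw [Finset.mem_Icc] at hnear hfnear ⊢
      rw [add_mul, one_mul]
      omega

/-- The leftward edges with both endpoints within distance `R` of `u`. -/
def leftEdgesNear (u : Fin n) (R : ℕ) : Finset (Fin n × Fin n) :=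
  {f | f.2 < f.1 ∧ (f.1 : ℕ) ∈ Finset.Icc ((u : ℕ) - R) (u + R) ∧
    (f.2 : ℕ) ∈ Finset.Icc ((u : ℕ) - R) (u + R)}

/-- The sets of `k` leftward edges that are all within distance `R` of a common vertex. -/
def leftClusters (n R k : ℕ) : Finset (Finset (Fin n × Fin n)) :=
  Finset.univ.biUnion fun u ↦ (leftEdgesNear u R).powersetCard k

theorem leftBounded_occupied_of_forall_leftClusters {m : ℕ} (hE₀ : LeftBounded E₀ 1)
    (hopen : ∀ A ∈ leftClusters n ((m + 1) * 2 ^ (m + 1)) (m + 1), ¬ ∀ f ∈ A, f ∈ Eopen) (t : ℕ) :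
    LeftBounded (occupied E₀ Eopen t) (2 ^ m) := by
  induction t with
  | zero =>
    exact fun e he ↦ (hE₀ e he).trans (Nat.add_le_add_left Nat.one_le_two_pow _)
  | succ t ih =>
    have hD : LeftBounded (occupied E₀ Eopen (t + 1)) (2 ^ (m + 1)) := by
      rw [pow_succ']
      exact ih.step
    intro e he
    by_contra! hlong
    obtain ⟨A, hcard, hA⟩ := exists_leftward_of_leftBounded hE₀ hD he hlong
    refine hopen A ?_ fun f hf ↦ (hA f hf).2.1
    simp only [leftClusters, Finset.mem_biUnion, Finset.mem_univ, true_and,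
      Finset.mem_powersetCard]
    refine ⟨e.1, fun f hf ↦ ?_, hcard⟩
    obtain ⟨hft, -, hfleft, hfnear⟩ := hA f hf
    have hfD := hD f hft
    simp only [leftEdgesNear, Finset.mem_filter, Finset.mem_univ, true_and, Finset.mem_Icc]
      at hfnear ⊢
    rw [add_mul, one_mul]
    omega

/-- Edges between elements of `Fin n`, viewed as edges between natural numbers. -/
def edgeVal (n : ℕ) : Fin n × Fin n ↪ ℕ × ℕ :=
  Fin.valEmbedding.prodMap Fin.valEmbedding

theorem card_leftEdgesNear_le (u : Fin n) (R : ℕ) :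
    (leftEdgesNear u R).card ≤ (2 * R + 1) ^ 2 := by
  have hsub : (leftEdgesNear u R).map (edgeVal n) ⊆
      Finset.Icc ((u : ℕ) - R) (u + R) ×ˢ Finset.Icc ((u : ℕ) - R) (u + R) := by
    intro x hx
    obtain ⟨f, hf, rfl⟩ := Finset.mem_map.1 hx
    exact Finset.mem_product.2 (Finset.mem_filter.1 hf).2.2
  calc (leftEdgesNear u R).card
      ≤ (u + R + 1 - (u - R)) ^ 2 := by
        simpa only [Finset.card_map, Finset.card_product, Nat.card_Icc, ← sq] using
          Finset.card_le_card hsub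
    _ ≤ (2 * R + 1) ^ 2 := Nat.pow_le_pow_left (by omega) 2

theorem card_leftClusters_le (n R k : ℕ) :
    (leftClusters n R k).card ≤ n * 2 ^ (2 * R + 1) ^ 2 := by
  calc (leftClusters n R k).card
      ≤ (Finset.univ : Finset (Fin n)).card * 2 ^ (2 * R + 1) ^ 2 := by
        refine Finset.card_biUnion_le_card_mul _ _ _ fun u _ ↦ ?_
        rw [Finset.card_powersetCard]
        exact (Nat.choose_le_two_pow _ _).trans
          (Nat.pow_le_pow_right two_pos (card_leftEdgesNear_le u R))
    _ = n * 2 ^ (2 * R + 1) ^ 2 := by rw [Finset.card_univ, Fintype.card_fin]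

theorem card_eq_and_lt_of_mem_leftClusters {R k : ℕ} {A : Finset (Fin n × Fin n)}
    (hA : A ∈ leftClusters n R k) : A.card = k ∧ ∀ f ∈ A, f.2 < f.1 := by
  simp only [leftClusters, Finset.mem_biUnion, Finset.mem_powersetCard] at hA
  obtain ⟨u, -, hsub, hcard⟩ := hA
  exact ⟨hcard, fun f hf ↦ (Finset.mem_filter.1 (hsub hf)).2.1⟩

end LeftwardEdges

section Words

/-- The letters of a word that steers a walk on `ℕ`, together with a stack of marked positions. -/
inductive Move
  | right
  | left
  | push
  | pop

instance : Fintype Move where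
  elems := ⟨{.right, .left, .push, .pop}, by simp⟩
  complete := by rintro ⟨⟩ <;> simp

theorem card_move : Fintype.card Move = 4 := rfl

/-- The edges recorded by a walk that starts at `p` with stack `s`: `push` marks the current
position, and `pop` records the edge from the last marked position to the current one. -/
def trace : ℕ → List ℕ → List Move → Finset (ℕ × ℕ)
  | _, _, [] => ∅
  | p, s, .right :: w => trace (p + 1) s w
  | p, s, .left :: w => trace (p - 1) s w
  | p, s, .push :: w => trace p (p :: s) w
  | p, a :: s, .pop :: w => insert (a, p) (trace p s w)
  | p, [], .pop :: w => trace p [] w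

theorem trace_replicate_right_append (k p : ℕ) (s : List ℕ) (w : List Move) :
    trace p s (List.replicate k .right ++ w) = trace (p + k) s w := by
  induction k generalizing p with
  | zero => rfl
  | succ k ih =>
    rw [List.replicate_succ, List.cons_append, trace, ih]
    congr 1
    omega

theorem trace_replicate_left_append (k p : ℕ) (s : List ℕ) (w : List Move) :
    trace p s (List.replicate k .left ++ w) = trace (p - k) s w := by
  induction k generalizing p with
  | zero => rfl
  | succ k ih =>
    rw [List.replicate_succ, List.cons_append, trace, ih]
    congr 1
    omega

theorem trace_replicate_push (k p : ℕ) (s : List ℕ) : trace p s (List.replicate k .push) = ∅ := by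
  induction k generalizing s with
  | zero => rfl
  | succ k ih => rw [List.replicate_succ, trace, ih]

/-- The word `w` leads from `a` to `b`, leaves the stack as it was, and records the edges `A`. -/
def Draws (w : List Move) (a b : ℕ) (A : Finset (ℕ × ℕ)) : Prop :=
  ∀ s w', trace a s (w ++ w') = A ∪ trace b s w'

theorem draws_straight (a b : ℕ) :
    Draws (List.replicate (b - a) .right ++ List.replicate (a - b) .left) a b ∅ := by
  intro s w'
  rw [List.append_assoc, trace_replicate_right_append, trace_replicate_left_append,
    Finset.empty_union]
  congr 1
  omega

theorem Draws.join {w₁ w₂ : List Move} {a k b : ℕ} {A₁ A₂ : Finset (ℕ × ℕ)}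
    (h₁ : Draws w₁ a k A₁) (h₂ : Draws w₂ k b A₂) :
    Draws (.push :: (w₁ ++ w₂ ++ [.pop])) a b (insert (a, b) (A₁ ∪ A₂)) := by
  intro s w'
  calc trace a s (.push :: (w₁ ++ w₂ ++ [.pop]) ++ w')
      = trace a (a :: s) (w₁ ++ (w₂ ++ .pop :: w')) := by
        simp only [List.cons_append, List.append_assoc, List.nil_append, trace]
    _ = A₁ ∪ (A₂ ∪ insert (a, b) (trace b s w')) := by rw [h₁, h₂, trace]
    _ = insert (a, b) (A₁ ∪ A₂) ∪ trace b s w' := by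
        simp only [Finset.union_insert, Finset.insert_union, Finset.union_assoc]

theorem Draws.exists_vector {w : List Move} {a b K : ℕ} {A : Finset (ℕ × ℕ)} (h : Draws w a b A)
    (hw : w.length ≤ K) : ∃ v : List.Vector Move K, trace a [] v.toList = A := by
  -- Marks that are never popped pad the word without recording anything.
  refine ⟨⟨w ++ List.replicate (K - w.length) .push, ?_⟩, ?_⟩
  · rw [List.length_append, List.length_replicate, Nat.add_sub_cancel' hw]
  · rw [List.Vector.toList_mk, h, trace_replicate_push, Finset.union_empty]

end Words

section RightwardEdges

variable {α : Type*} [LinearOrder α] [LocallyFiniteOrder α]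

/-- The points that lie strictly between the endpoints of some rightward edge in `S`. -/
def interiorPoints (S : Finset (α × α)) : Finset α :=
  S.biUnion fun e ↦ Finset.Ioo e.1 e.2

theorem Ioo_subset_interiorPoints {S : Finset (α × α)} {e : α × α} (he : e ∈ S) :
    Finset.Ioo e.1 e.2 ⊆ interiorPoints S :=
  Finset.subset_biUnion_of_mem (fun e : α × α ↦ Finset.Ioo e.1 e.2) he

theorem interiorPoints_insert (e : α × α) (S : Finset (α × α)) :
    interiorPoints (insert e S) = Finset.Ioo e.1 e.2 ∪ interiorPoints S :=
  Finset.biUnion_insert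

theorem interiorPoints_mono {S T : Finset (α × α)} (h : S ⊆ T) :
    interiorPoints S ⊆ interiorPoints T :=
  Finset.biUnion_subset_biUnion_of_subset_left _ h

theorem Ioo_subset_insert_Ioo_union_Ioo (a k b : α) :
    Finset.Ioo a b ⊆ insert k (Finset.Ioo a k ∪ Finset.Ioo k b) := by
  intro v hv
  simp only [Finset.mem_insert, Finset.mem_union, Finset.mem_Ioo] at hv ⊢
  rcases lt_trichotomy v k with h | h | h
  · exact .inr (.inl ⟨hv.1, h⟩)
  · exact .inl h
  · exact .inr (.inr ⟨h, hv.2⟩)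

variable {n : ℕ}

/-- A set `A` of edges that explains how `a → b` became occupied, given that the edges in `S` have
been explained before: `A` consists of new edges in `E`, is drawn by a word whose length is linear
in `b - a` and in the size of `A`, and each of its edges accounts for at most one new interior
point. -/
structure IsExploration (E : Set (Fin n × Fin n)) (M : ℕ) (S A : Finset (Fin n × Fin n))
    (a b : Fin n) : Prop where
  subset : ∀ f ∈ A, f ∈ E
  disjoint : Disjoint S A
  card_interiorPoints_le :
    (interiorPoints (S ∪ A)).card ≤ (interiorPoints S).card + A.card
  Ioo_subset : Finset.Ioo a b ⊆ interiorPoints (S ∪ A)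
  exists_draws : ∃ w : List Move, Draws w a b (A.map (edgeVal n)) ∧
    w.length + a ≤ b + 2 * M + (2 * M + 2) * A.card

namespace IsExploration

variable {E E' : Set (Fin n × Fin n)} {M : ℕ} {S A A₁ A₂ : Finset (Fin n × Fin n)} {a k b : Fin n}

theorem mono (h : IsExploration E M S A a b) (hE : E ⊆ E') : IsExploration E' M S A a b :=
  { h with subset := fun f hf ↦ hE (h.subset f hf) }

theorem empty (hS : Finset.Ioo a b ⊆ interiorPoints S) (hM : (a : ℕ) ≤ b + M) :
    IsExploration E M S ∅ a b where
  subset := by simp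
  disjoint := Finset.disjoint_empty_right S
  card_interiorPoints_le := by simp
  Ioo_subset := by rwa [Finset.union_empty]
  exists_draws := by
    refine ⟨_, draws_straight a b, ?_⟩
    simp only [List.length_append, List.length_replicate, Finset.card_empty]
    omega

theorem interiorPoints_union_insert_subset (h₁ : IsExploration E M S A₁ a k)
    (h₂ : IsExploration E M (S ∪ A₁) A₂ k b) :
    interiorPoints (S ∪ insert (a, b) (A₁ ∪ A₂)) ⊆ insert k (interiorPoints (S ∪ A₁ ∪ A₂)) := by
  rw [Finset.union_insert, interiorPoints_insert, ← Finset.union_assoc]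
  refine Finset.union_subset ((Ioo_subset_insert_Ioo_union_Ioo a k b).trans ?_)
    (Finset.subset_insert _ _)
  exact Finset.insert_subset_insert k (Finset.union_subset
    (h₁.Ioo_subset.trans (interiorPoints_mono Finset.subset_union_left)) h₂.Ioo_subset)

theorem join (h₁ : IsExploration E M S A₁ a k) (h₂ : IsExploration E M (S ∪ A₁) A₂ k b)
    (hE : (a, b) ∉ E) (hS : (a, b) ∉ S) :
    IsExploration (insert (a, b) E) M S (insert (a, b) (A₁ ∪ A₂)) a b := by
  obtain ⟨hSA₂, hA₁A₂⟩ := Finset.disjoint_union_left.1 h₂.disjoint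
  have hsub : ∀ f ∈ A₁ ∪ A₂, f ∈ E := fun f hf ↦
    (Finset.mem_union.1 hf).elim (h₁.subset f) (h₂.subset f)
  have hcard : (insert (a, b) (A₁ ∪ A₂)).card = A₁.card + A₂.card + 1 := by
    rw [Finset.card_insert_of_notMem fun h ↦ hE (hsub _ h), Finset.card_union_of_disjoint hA₁A₂]
  refine ⟨?_, ?_, ?_, ?_, ?_⟩
  · exact Finset.forall_mem_insert _ _ _ |>.2
      ⟨Set.mem_insert _ _, fun f hf ↦ Set.mem_insert_of_mem _ (hsub f hf)⟩
  · rw [Finset.disjoint_insert_right, Finset.disjoint_union_right]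
    exact ⟨hS, h₁.disjoint, hSA₂⟩
  · calc (interiorPoints (S ∪ insert (a, b) (A₁ ∪ A₂))).card
        ≤ (interiorPoints (S ∪ A₁ ∪ A₂)).card + 1 :=
          (Finset.card_le_card (h₁.interiorPoints_union_insert_subset h₂)).trans
            (Finset.card_insert_le _ _)
      _ ≤ (interiorPoints S).card + A₁.card + A₂.card + 1 := by
          have := h₁.card_interiorPoints_le
          have := h₂.card_interiorPoints_le
          omega
      _ = (interiorPoints S).card + (insert (a, b) (A₁ ∪ A₂)).card := by
          rw [hcard, add_assoc, add_assoc, add_assoc]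
  · exact Ioo_subset_interiorPoints (e := (a, b))
      (Finset.mem_union_right S (Finset.mem_insert_self _ _))
  · obtain ⟨w₁, hw₁, hlen₁⟩ := h₁.exists_draws
    obtain ⟨w₂, hw₂, hlen₂⟩ := h₂.exists_draws
    refine ⟨.push :: (w₁ ++ w₂ ++ [.pop]), ?_, ?_⟩
    · rw [Finset.map_insert, Finset.map_union]
      exact hw₁.join hw₂
    rw [hcard]
    simp only [List.length_cons, List.length_append, List.length_nil]
    linarith

end IsExploration

theorem exists_isExploration {E₀ Eopen : Set (Fin n × Fin n)} {M : ℕ}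
    (hE₀ : ∀ e ∈ E₀, (e.2 : ℕ) ≤ e.1 + 1) (hM : ∀ t, LeftBounded (occupied E₀ Eopen t) M)
    {t : ℕ} {e : Fin n × Fin n} (he : e ∈ occupied E₀ Eopen t) (S : Finset (Fin n × Fin n)) :
    ∃ A, IsExploration {f ∈ occupied E₀ Eopen t | f ∈ Eopen ∧ f.1 < f.2} M S A e.1 e.2 := by
  induction t generalizing e S with
  | zero =>
    have hIoo : Finset.Ioo e.1 e.2 = ∅ := by
      have := hE₀ e he
      rw [← Finset.card_eq_zero, Fin.card_Ioo]
      omega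
    exact ⟨∅, .empty (by simp [hIoo]) (hM 0 e he)⟩
  | succ t ih =>
    have hmono : {f ∈ occupied E₀ Eopen t | f ∈ Eopen ∧ f.1 < f.2} ⊆
        {f ∈ occupied E₀ Eopen (t + 1) | f ∈ Eopen ∧ f.1 < f.2} := fun f hf ↦
      ⟨occupied_subset_occupied_succ hf.1, hf.2⟩
    by_cases het : e ∈ occupied E₀ Eopen t
    · obtain ⟨A, hA⟩ := ih het S
      exact ⟨A, hA.mono hmono⟩
    by_cases hS : Finset.Ioo e.1 e.2 ⊆ interiorPoints S
    · exact ⟨∅, .empty hS (hM (t + 1) e he)⟩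
    obtain ⟨hopen, k, hk₁, hk₂⟩ := mem_open_and_exists_of_mem_occupied_succ he het
    obtain ⟨A₁, hA₁⟩ := ih hk₁ S
    obtain ⟨A₂, hA₂⟩ := ih hk₂ (S ∪ A₁)
    have hright : e.1 < e.2 := by
      contrapose! hS
      rw [Finset.Ioo_eq_empty hS.not_gt]
      exact Finset.empty_subset _
    exact ⟨_, (hA₁.join hA₂ (fun h ↦ het h.1) fun h ↦ hS (Ioo_subset_interiorPoints h)).mono
      (Set.insert_subset ⟨he, hopen, hright⟩ hmono)⟩

/-- The sets of `N` rightward edges that are drawn by a word of length `K`. -/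
def rightTraces (n K N : ℕ) : Finset (Finset (Fin n × Fin n)) :=
  {A | A.card = N ∧ (∀ f ∈ A, f.1 < f.2) ∧
    ∃ (i : Fin n) (v : List.Vector Move K), trace i [] v.toList = A.map (edgeVal n)}

theorem card_rightTraces_le (n K N : ℕ) : (rightTraces n K N).card ≤ n * 4 ^ K := by
  have hsub : (rightTraces n K N).map (Finset.mapEmbedding (edgeVal n)).toEmbedding ⊆
      (Finset.univ : Finset (Fin n × List.Vector Move K)).image fun x ↦
        trace x.1 [] x.2.toList := by
    intro x hx
    obtain ⟨A, hA, rfl⟩ := Finset.mem_map.1 hx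
    obtain ⟨-, -, i, v, h⟩ := (Finset.mem_filter.1 hA).2
    exact Finset.mem_image.2 ⟨(i, v), Finset.mem_univ _, h⟩
  calc (rightTraces n K N).card
      ≤ Fintype.card (Fin n × List.Vector Move K) := by
        simpa only [Finset.card_map, Finset.card_univ] using
          (Finset.card_le_card hsub).trans Finset.card_image_le
    _ = n * 4 ^ K := by rw [Fintype.card_prod, Fintype.card_fin, card_vector, card_move]

theorem exists_rightTraces_of_mem_occupied {E₀ Eopen : Set (Fin n × Fin n)} {M t : ℕ}
    (hE₀ : ∀ e ∈ E₀, (e.2 : ℕ) ≤ e.1 + 1) (hM : ∀ t, LeftBounded (occupied E₀ Eopen t) M)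
    {e : Fin n × Fin n} (he : e ∈ occupied E₀ Eopen t) :
    ∃ N, (e.2 : ℕ) ≤ e.1 + 1 + N ∧
      ∃ A ∈ rightTraces n ((2 * M + 3) * (N + 1)) N, ∀ f ∈ A, f ∈ Eopen := by
  obtain ⟨A, hA⟩ := exists_isExploration hE₀ hM he ∅
  obtain ⟨w, hw, hlen⟩ := hA.exists_draws
  have hcard : (e.2 : ℕ) - e.1 - 1 ≤ A.card := by
    calc (e.2 : ℕ) - e.1 - 1 = (Finset.Ioo e.1 e.2).card := (Fin.card_Ioo ..).symm
      _ ≤ (interiorPoints (∅ ∪ A)).card := Finset.card_le_card hA.Ioo_subset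
      _ ≤ A.card := by simpa [interiorPoints] using hA.card_interiorPoints_le
  obtain ⟨v, hv⟩ := hw.exists_vector (K := (2 * M + 3) * (A.card + 1)) (by
    have : (e.2 : ℕ) ≤ e.1 + 1 + A.card := by omega
    linarith)
  refine ⟨A.card, by omega, A, ?_, fun f hf ↦ (hA.subset f hf).2.1⟩
  simp only [rightTraces, Finset.mem_filter, Finset.mem_univ, true_and]
  exact ⟨fun f hf ↦ (hA.subset f hf).2.2, e.1, v, hv⟩

end RightwardEdges

section Probability

theorem measureReal_pi_bernoulli_forall {ι : Type*} [Fintype ι] (p : ι → unitInterval)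
    (A : Finset ι) :
    (Measure.pi fun i ↦ bernoulliMeasure true false (p i)).real {ω | ∀ i ∈ A, ω i = true} =
      ∏ i ∈ A, (p i : ℝ) := by
  have hcylinder : {ω : ι → Bool | ∀ i ∈ A, ω i = true} = (A : Set ι).pi fun _ ↦ {true} := by
    ext ω
    simp [Set.mem_pi]
  rw [hcylinder, measureReal_def, Measure.pi_pi_finset, ENNReal.toReal_prod]
  exact Finset.prod_congr rfl fun i _ ↦ bernoulliMeasure_real_apply_of_mem_of_notMem _
    (MeasurableSet.singleton _) (by simp) (by simp)

theorem measureReal_pi_bernoulli_exists_forall_le {ι : Type*} [Fintype ι] (p : ι → unitInterval)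
    {F : Finset (Finset ι)} {N : ℕ} {q : ℝ} (hF : ∀ A ∈ F, A.card = N ∧ ∀ i ∈ A, (p i : ℝ) ≤ q) :
    (Measure.pi fun i ↦ bernoulliMeasure true false (p i)).real
      {ω | ∃ A ∈ F, ∀ i ∈ A, ω i = true} ≤ F.card * q ^ N := by
  set μ := Measure.pi fun i ↦ bernoulliMeasure true false (p i)
  calc μ.real {ω | ∃ A ∈ F, ∀ i ∈ A, ω i = true}
      = μ.real (⋃ A ∈ F, {ω | ∀ i ∈ A, ω i = true}) := by
        congr 1
        ext ω
        simp
    _ ≤ ∑ A ∈ F, μ.real {ω | ∀ i ∈ A, ω i = true} := measureReal_biUnion_finset_le _ _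
    _ ≤ ∑ _A ∈ F, q ^ N := by
        refine Finset.sum_le_sum fun A hA ↦ ?_
        obtain ⟨rfl, hq⟩ := hF A hA
        rw [measureReal_pi_bernoulli_forall, ← Finset.prod_const]
        exact Finset.prod_le_prod (fun i _ ↦ (p i).2.1) hq
    _ = F.card * q ^ N := by rw [Finset.sum_const, nsmul_eq_mul]

theorem tendsto_measure_compl_one {ι : Type*} {l : Filter ι} {Ω : ι → Type*}
    [∀ i, MeasurableSpace (Ω i)] {μ : ∀ i, Measure (Ω i)} [∀ i, IsProbabilityMeasure (μ i)]
    {s : ∀ i, Set (Ω i)} (hs : ∀ i, MeasurableSet (s i))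
    (h : Tendsto (fun i ↦ (μ i).real (s i)) l (𝓝 0)) :
    Tendsto (fun i ↦ μ i (s i)ᶜ) l (𝓝 1) := by
  have hreal : Tendsto (fun i ↦ (μ i).real (s i)ᶜ) l (𝓝 1) := by
    simpa only [probReal_compl_eq_one_sub (hs _), sub_zero] using h.const_sub 1
  rw [← ENNReal.ofReal_one]
  exact (ENNReal.tendsto_ofReal hreal).congr fun i ↦ ofReal_measureReal

variable {n : ℕ} {pLeft pRight : unitInterval}

instance : IsProbabilityMeasure (configMeasure n pLeft pRight) := by
  unfold configMeasure
  infer_instance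

theorem measureReal_exists_leftClusters_le (R k : ℕ) :
    (configMeasure n pLeft pRight).real
      {ω | ∃ A ∈ leftClusters n R k, ∀ f ∈ A, ω f = true} ≤
      n * 2 ^ (2 * R + 1) ^ 2 * (pLeft : ℝ) ^ k := by
  have hdensity : ∀ A ∈ leftClusters n R k, A.card = k ∧
      ∀ f ∈ A, (edgeDensity pLeft pRight f : ℝ) ≤ pLeft := fun A hA ↦
    (card_eq_and_lt_of_mem_leftClusters hA).imp_right fun h f hf ↦ by
      rw [edgeDensity, if_neg (h f hf).not_gt]
  refine (measureReal_pi_bernoulli_exists_forall_le _ hdensity).trans ?_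
  gcongr
  · exact pow_nonneg pLeft.2.1 _
  · exact_mod_cast card_leftClusters_le n R k

theorem measureReal_exists_rightTraces_le (K N : ℕ) :
    (configMeasure n pLeft pRight).real
      {ω | ∃ A ∈ rightTraces n K N, ∀ f ∈ A, ω f = true} ≤
      n * 4 ^ K * (pRight : ℝ) ^ N := by
  have hdensity : ∀ A ∈ rightTraces n K N, A.card = N ∧
      ∀ f ∈ A, (edgeDensity pLeft pRight f : ℝ) ≤ pRight := fun A hA ↦ by
    obtain ⟨hcard, hright, -⟩ := (Finset.mem_filter.1 hA).2
    exact ⟨hcard, fun f hf ↦ by rw [edgeDensity, if_pos (hright f hf)]⟩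
  refine (measureReal_pi_bernoulli_exists_forall_le _ hdensity).trans ?_
  gcongr
  · exact pow_nonneg pRight.2.1 _
  · exact_mod_cast card_rightTraces_le n K N

end Probability

section LinearGraph

variable {n : ℕ}

theorem dist_pathGraph_le {i j : Fin n} (hij : i ≤ j) :
    (SimpleGraph.pathGraph n).dist i j ≤ j - i := by
  obtain ⟨d, hd⟩ := Nat.exists_eq_add_of_le (Fin.le_def.1 hij)
  suffices ∃ w : (SimpleGraph.pathGraph n).Walk i j, w.length = d by
    obtain ⟨w, hw⟩ := this
    have := SimpleGraph.dist_le w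
    omega
  clear hij
  induction d generalizing i with
  | zero =>
    obtain rfl : i = j := Fin.ext (by omega)
    exact ⟨.nil, rfl⟩
  | succ d ih =>
    obtain ⟨w, hw⟩ := ih (i := ⟨i + 1, by omega⟩) (by dsimp only; omega)
    exact ⟨.cons (SimpleGraph.pathGraph_adj.2 (.inl rfl)) w,
      by rw [SimpleGraph.Walk.length_cons, hw]⟩

theorem edgeLength_le_of_le {e : Fin n × Fin n} (he : e.1 ≤ e.2) : edgeLength e ≤ e.2 - e.1 :=
  dist_pathGraph_le he

theorem edgeLength_le_of_ge {e : Fin n × Fin n} (he : e.2 ≤ e.1) : edgeLength e ≤ e.1 - e.2 := by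
  rw [edgeLength, SimpleGraph.dist_comm]
  exact dist_pathGraph_le he

theorem leftBounded_orientedEdges_pathGraph :
    LeftBounded (orientedEdges (SimpleGraph.pathGraph n)) 1 := fun e he ↦ by
  have := SimpleGraph.pathGraph_adj.1 he
  omega

theorem exists_leftClusters_or_exists_rightTraces {m ℓ : ℕ} {ω : Fin n × Fin n → Bool}
    (hm : 2 ^ m ≤ ℓ) (hω : ∃ e ∈ linearFinal n ω, ℓ < edgeLength e) :
    (∃ A ∈ leftClusters n ((m + 1) * 2 ^ (m + 1)) (m + 1), ∀ f ∈ A, ω f = true) ∨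
      ∃ N ∈ Finset.Icc ℓ (n ^ 2),
        ∃ A ∈ rightTraces n ((2 * 2 ^ m + 3) * (N + 1)) N, ∀ f ∈ A, ω f = true := by
  rw [or_iff_not_imp_left]
  intro hleft
  obtain ⟨e, he, hlong⟩ := hω
  obtain ⟨t, het⟩ := Set.mem_iUnion.1 he
  have hbounded := leftBounded_occupied_of_forall_leftClusters
    (Eopen := openEdges (orientedEdges (SimpleGraph.pathGraph n)) ω)
    leftBounded_orientedEdges_pathGraph fun A hA h ↦ hleft ⟨A, hA, fun f hf ↦ (h f hf).2.2⟩
  have hright : e.1 ≤ e.2 := by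
    by_contra! h
    have := edgeLength_le_of_ge h.le
    have := hbounded t e het
    omega
  obtain ⟨N, hN, A, hA, hopen⟩ := exists_rightTraces_of_mem_occupied (fun e he ↦ by
    have := SimpleGraph.pathGraph_adj.1 he
    omega) hbounded het
  refine ⟨N, Finset.mem_Icc.2 ⟨?_, ?_⟩, A, hA, fun f hf ↦ (hopen f hf).2.2⟩
  · have := edgeLength_le_of_le hright
    omega
  · calc N = A.card := (Finset.mem_filter.1 hA).2.1.symm
      _ ≤ Fintype.card (Fin n × Fin n) := Finset.card_le_univ A
      _ = n ^ 2 := by rw [Fintype.card_prod, Fintype.card_fin, sq]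

theorem measureReal_exists_long_le {m ℓ : ℕ} {pLeft pRight : unitInterval} (hm : 2 ^ m ≤ ℓ) :
    (configMeasure n pLeft pRight).real {ω | ∃ e ∈ linearFinal n ω, ℓ < edgeLength e} ≤
      n * 2 ^ (2 * ((m + 1) * 2 ^ (m + 1)) + 1) ^ 2 * (pLeft : ℝ) ^ (m + 1) +
        ∑ N ∈ Finset.Icc ℓ (n ^ 2),
          n * 4 ^ ((2 * 2 ^ m + 3) * (N + 1)) * (pRight : ℝ) ^ N := by
  set μ := configMeasure n pLeft pRight
  calc μ.real {ω | ∃ e ∈ linearFinal n ω, ℓ < edgeLength e}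
      ≤ μ.real ({ω | ∃ A ∈ leftClusters n ((m + 1) * 2 ^ (m + 1)) (m + 1), ∀ f ∈ A, ω f = true} ∪
          ⋃ N ∈ Finset.Icc ℓ (n ^ 2),
            {ω | ∃ A ∈ rightTraces n ((2 * 2 ^ m + 3) * (N + 1)) N, ∀ f ∈ A, ω f = true}) := by
        refine measureReal_mono fun ω hω ↦ ?_
        exact (exists_leftClusters_or_exists_rightTraces hm hω).imp_right fun ⟨N, hN, h⟩ ↦
          Set.mem_biUnion (Finset.mem_coe.2 hN) h
    _ ≤ _ := (measureReal_union_le _ _).trans (add_le_add (measureReal_exists_leftClusters_le _ _)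
        ((measureReal_biUnion_finset_le _ _).trans
          (Finset.sum_le_sum fun N _ ↦ measureReal_exists_rightTraces_le _ _)))

end LinearGraph

section Asymptotics

theorem pow_le_inv_sq_of_le_rpow_neg {x p c : ℝ} {k : ℕ} (hx : 1 ≤ x) (hp : 0 ≤ p)
    (hpx : p ≤ x ^ (-c)) (hck : 2 ≤ c * k) : p ^ k ≤ x⁻¹ ^ 2 := by
  have hx₀ : 0 ≤ x := zero_le_one.trans hx
  calc p ^ k ≤ (x ^ (-c)) ^ k := pow_le_pow_left₀ hp hpx k
    _ = x ^ (-(c * k)) := by rw [← Real.rpow_mul_natCast hx₀, neg_mul]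
    _ ≤ x ^ (-2 : ℝ) := Real.rpow_le_rpow_of_exponent_le hx (neg_le_neg hck)
    _ = x⁻¹ ^ 2 := by rw [Real.rpow_neg hx₀, Real.rpow_two, inv_pow]

theorem pow_mul_pow_le_of_le_exp {x b p r : ℝ} {L N : ℕ} (hx : 0 < x) (hb : 0 ≤ b) (hp : 0 ≤ p)
    (hbp : b ^ L * p ≤ Real.exp (-r)) (hr : 0 ≤ r) (hN : Real.log x ≤ N + 1) :
    b ^ (L * (N + 1)) * p ^ N ≤ b ^ L * Real.exp r * x ^ (-r) := by
  calc b ^ (L * (N + 1)) * p ^ N = b ^ L * (b ^ L * p) ^ N := by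
        rw [pow_mul, pow_succ, mul_pow]
        ring
    _ ≤ b ^ L * Real.exp (-r) ^ N := by gcongr
    _ ≤ b ^ L * (Real.exp r * x ^ (-r)) := by
        gcongr
        rw [Real.rpow_def_of_pos hx, ← Real.exp_nat_mul, ← Real.exp_add, Real.exp_le_exp]
        nlinarith
    _ = b ^ L * Real.exp r * x ^ (-r) := by ring

-- In `hRight`, the exponent 4 pays for the choice of the starting vertex and for the `O(n ^ 2)`
-- values of `N`, with a factor `n⁻¹` to spare.
theorem measureReal_exists_gt_log_le {n m : ℕ} {c : ℝ} {pLeft pRight : unitInterval} (hn : n ≠ 0)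
    (hm : 2 ^ m ≤ ⌊Real.log n⌋₊) (hc : 2 ≤ c * (m + 1 : ℕ)) (hLeft : (pLeft : ℝ) ≤ (n : ℝ) ^ (-c))
    (hRight : 4 ^ (2 * 2 ^ m + 3) * (pRight : ℝ) ≤ Real.exp (-4)) :
    (configMeasure n pLeft pRight).real
      {ω | ∃ e ∈ linearFinal n ω, Real.log n < edgeLength e} ≤
      (2 ^ (2 * ((m + 1) * 2 ^ (m + 1)) + 1) ^ 2 + 2 * (4 ^ (2 * 2 ^ m + 3) * Real.exp 4)) *
        (n : ℝ)⁻¹ := by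
  set W : ℝ := 2 ^ (2 * ((m + 1) * 2 ^ (m + 1)) + 1) ^ 2
  set B : ℝ := 4 ^ (2 * 2 ^ m + 3) * Real.exp 4
  have hn₁ : (1 : ℝ) ≤ n := by exact_mod_cast Nat.one_le_iff_ne_zero.2 hn
  have hn₀ : (0 : ℝ) < n := zero_lt_one.trans_le hn₁
  have hterm : ∀ N ∈ Finset.Icc ⌊Real.log n⌋₊ (n ^ 2),
      n * 4 ^ ((2 * 2 ^ m + 3) * (N + 1)) * (pRight : ℝ) ^ N ≤ n * (B * (n : ℝ) ^ (-4 : ℝ)) := by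
    intro N hN
    rw [mul_assoc]
    refine mul_le_mul_of_nonneg_left ?_ hn₀.le
    refine pow_mul_pow_le_of_le_exp hn₀ (by norm_num) pRight.2.1 hRight (by norm_num) ?_
    calc Real.log n ≤ ⌊Real.log n⌋₊ + 1 := (Nat.lt_floor_add_one _).le
      _ ≤ N + 1 := by gcongr; exact (Finset.mem_Icc.1 hN).1
  have hcard : ((Finset.Icc ⌊Real.log n⌋₊ (n ^ 2)).card : ℝ) ≤ 2 * n ^ 2 := by
    have : 1 ≤ n ^ 2 := Nat.one_le_pow _ _ (Nat.pos_of_ne_zero hn)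
    rw [Nat.card_Icc]
    exact_mod_cast (by omega : n ^ 2 + 1 - ⌊Real.log n⌋₊ ≤ 2 * n ^ 2)
  calc (configMeasure n pLeft pRight).real {ω | ∃ e ∈ linearFinal n ω, Real.log n < edgeLength e}
      ≤ n * W * (pLeft : ℝ) ^ (m + 1) + ∑ N ∈ Finset.Icc ⌊Real.log n⌋₊ (n ^ 2),
          n * 4 ^ ((2 * 2 ^ m + 3) * (N + 1)) * (pRight : ℝ) ^ N := by
        simpa only [Nat.floor_lt (Real.log_nonneg hn₁)] using measureReal_exists_long_le hm
    _ ≤ n * W * (n : ℝ)⁻¹ ^ 2 + 2 * n ^ 2 * (n * (B * (n : ℝ) ^ (-4 : ℝ))) := by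
        gcongr
        · exact pow_le_inv_sq_of_le_rpow_neg hn₁ pLeft.2.1 hLeft hc
        · refine (Finset.sum_le_card_nsmul _ _ _ hterm).trans ?_
          rw [nsmul_eq_mul]
          gcongr
    _ = (W + 2 * B) * (n : ℝ)⁻¹ := by
        rw [Real.rpow_neg hn₀.le, show (4 : ℝ) = (4 : ℕ) by norm_num, Real.rpow_natCast]
        field_simp

theorem tendsto_measureReal_exists_gt_log {m : ℕ} {c : ℝ} {pLeft pRight : ℕ → unitInterval}
    (hc : 2 ≤ c * (m + 1 : ℕ)) (hLeft : ∀ᶠ n : ℕ in atTop, (pLeft n : ℝ) ≤ (n : ℝ) ^ (-c))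
    (hRight : ∀ᶠ n in atTop, 4 ^ (2 * 2 ^ m + 3) * (pRight n : ℝ) ≤ Real.exp (-4)) :
    Tendsto (fun n : ℕ ↦ (configMeasure n (pLeft n) (pRight n)).real
      {ω | ∃ e ∈ linearFinal n ω, Real.log n < edgeLength e}) atTop (𝓝 0) := by
  have hlog : ∀ᶠ n : ℕ in atTop, 2 ^ m ≤ ⌊Real.log n⌋₊ :=
    (tendsto_nat_floor_atTop.comp
      (Real.tendsto_log_atTop.comp tendsto_natCast_atTop_atTop)).eventually_ge_atTop _
  have hbound := ((eventually_ne_atTop 0).and (hlog.and (hLeft.and hRight))).mono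
    fun n ⟨hn, hm, hl, hr⟩ ↦ measureReal_exists_gt_log_le hn hm hc hl hr
  refine squeeze_zero' (.of_forall fun n ↦ measureReal_nonneg) hbound ?_
  simpa only [mul_zero] using (tendsto_inv_atTop_nhds_zero_nat (𝕜 := ℝ)).const_mul _

end Asymptotics

end TransitiveClosure

theorem theorem3 (c₁ : ℝ) (hc₁ : 0 < c₁) :
    ∃ c₂ : ℝ, 0 < c₂ ∧
      ∀ pLeft pRight : ℕ → unitInterval,
        (∀ᶠ n : ℕ in atTop, (pLeft n : ℝ) < (n : ℝ) ^ (-c₁) ∧ (pRight n : ℝ) < c₂) →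
        Tendsto
          (fun n : ℕ => TransitiveClosure.configMeasure n (pLeft n) (pRight n)
            {ω | ¬ ∃ e ∈ TransitiveClosure.linearFinal n ω,
              Real.log (n : ℝ) < (TransitiveClosure.edgeLength e : ℝ)})
          atTop (𝓝 1) := by
  obtain ⟨m, hm⟩ := exists_nat_ge (2 / c₁)
  refine ⟨Real.exp (-4) / 4 ^ (2 * 2 ^ m + 3), by positivity, fun pLeft pRight hp ↦ ?_⟩
  have hc : 2 ≤ c₁ * (m + 1 : ℕ) := by
    rw [div_le_iff₀ hc₁] at hm
    push_cast
    linarith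
  refine TransitiveClosure.tendsto_measure_compl_one (fun n ↦ .of_discrete)
    (TransitiveClosure.tendsto_measureReal_exists_gt_log hc (hp.mono fun n h ↦ h.1.le) ?_)
  filter_upwards [hp] with n hn
  rw [mul_comm]
  exact ((lt_div_iff₀ (by positivity)).1 hn.2).le
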